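/- Let $H$ be a separable infinite-dimensional (complex) Hilbert space and let $I$ be a non-empty countable index set. Let $\ast_{I}\mathbb{R}$ be the free topological product of copies of the topological group $(\mathbb{R},+)$ indexed by $I$, that is, the algebraic free product with its canonical embeddings $\iota_i:\mathbb{R}\to\ast_I\mathbb{R}$, endowed with the finest group topology making every $\iota_i$ continuous. Let $\ast_{I}\mathbb{R}_{\ge 0}\subseteq\ast_I\mathbb{R}$ be the submonoid of all finite products $\iota_{i_1}(t_1)\cdots\iota_{i_N}(t_N)$ with $N\ge 0$, $i_k\in I$ and $t_k\ge 0$, endowed with the relative topology. Let $X$ be the set of all SOT-continuous contractive semigroups over $\ast_I\mathbb{R}_{\ge 0}$ on $H$, i.e. of all maps $\mathcal{T}:\ast_I\mathbb{R}_{\ge 0}\to B(H)$ that are continuous for the strong operator topology and satisfy $\mathcal{T}(e)=\mathbf{1}$, $\mathcal{T}(xy)=\mathcal{T}(x)\mathcal{T}(y)$ and $\|\mathcal{T}(x)\|\le 1$ for all $x,y$. Endow $X$ with the topology $k_{\mathrm{WOT}}$ of uniform weak convergence on compact sets, in which $\mathcal{T}^{(\alpha)}\to\mathcal{T}$ if and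 only if $$\sup_{x\in K}\bigl|\langle(\mathcal{T}^{(\alpha)}(x)-\mathcal{T}(x))\xi,\eta\rangle\bigr|\longrightarrow 0$$ for all compact $K\subseteq\ast_I\mathbb{R}_{\ge 0}$ and all $\xi,\eta\in H$. Then the subset $X_u\subseteq X$ of unitary semigroups (those $\mathcal{T}\in X$ for which every $\mathcal{T}(x)$ is a unitary operator on $H$) is a dense $G_\delta$ subset of $(X,k_{\mathrm{WOT}})$. -/

import Mathlib

open scoped Topology

section FreeTopologicalProduct

variable {I : Type*} (G : I → Type*) [∀ i, Group (G i)]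

/-- The underlying group of the free topological product of the groups `G i`:
the algebraic free product (coproduct of groups). -/
def FreeTopProd : Type _ := Monoid.CoprodI G

namespace FreeTopProd

instance : Group (FreeTopProd G) := inferInstanceAs (Group (Monoid.CoprodI G))

variable {G}

/-- The canonical homomorphism `ι i : G i → *_i G i`. -/
def ι (i : I) : G i →* FreeTopProd G := Monoid.CoprodI.of

variable [∀ i, TopologicalSpace (G i)]

variable (G) in
/-- The topology of the free topological product: the finest group topology on the algebraic free
product for which every `ι i` is continuous. (In Mathlib's order on group topologies, smaller
means finer, so the finest one is the infimum.) -/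
def groupTopology : GroupTopology (FreeTopProd G) :=
  sInf {t : GroupTopology (FreeTopProd G) |
    ∀ i, @Continuous (G i) (FreeTopProd G) _ t.toTopologicalSpace (ι i)}

instance : TopologicalSpace (FreeTopProd G) := (groupTopology G).toTopologicalSpace

instance : IsTopologicalGroup (FreeTopProd G) := (groupTopology G).toIsTopologicalGroup

theorem continuous_ι (i : I) : Continuous (ι i : G i → FreeTopProd G) := by
  refine continuous_sInf_rng.2 ?_
  rintro _ ⟨t, ht, rfl⟩
  exact ht i

/-- The universal property of the free topological product. -/
theorem exists_continuous_lift {Γ : Type*} [Group Γ] [TopologicalSpace Γ] [IsTopologicalGroup Γ]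
    (θ : ∀ i, G i →* Γ) (hθ : ∀ i, Continuous (θ i)) :
    ∃ Θ : FreeTopProd G →* Γ, Continuous Θ ∧ ∀ i, Θ.comp (ι i) = θ i := by
  let Θ : FreeTopProd G →* Γ := Monoid.CoprodI.lift θ
  have hΘ : ∀ i, Θ.comp (ι i) = θ i := fun i => Monoid.CoprodI.lift_comp_of θ i
  refine ⟨Θ, ?_, hΘ⟩
  let t : GroupTopology (FreeTopProd G) :=
    { toTopologicalSpace := TopologicalSpace.induced Θ inferInstance
      toIsTopologicalGroup := topologicalGroup_induced Θ }
  have ht : groupTopology G ≤ t := sInf_le fun i => continuous_induced_rng.2 <| by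
    have h : (Θ ∘ ι i : G i → Γ) = θ i := by rw [← hΘ i]; rfl
    rw [h]
    exact hθ i
  exact continuous_iff_le_induced.2 (GroupTopology.toTopologicalSpace_le.2 ht)

/-- The submonoid `*_i M i` of `*_i G i` of all finite products of elements `ι i x` with
`x ∈ M i`. As a subtype it carries the relative topology. -/
def freeSubmonoid (M : ∀ i, Submonoid (G i)) : Submonoid (FreeTopProd G) where
  carrier := {x | ∃ l : List (Σ i, G i), (∀ p ∈ l, p.2 ∈ M p.1) ∧
    (l.map fun p => ι p.1 p.2).prod = x}
  one_mem' := ⟨[], by simp, by simp⟩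
  mul_mem' := by
    rintro _ _ ⟨l, hl, rfl⟩ ⟨m, hm, rfl⟩
    refine ⟨l ++ m, fun p hp => ?_, by simp⟩
    rcases List.mem_append.1 hp with h | h
    exacts [hl p h, hm p h]

end FreeTopProd

end FreeTopologicalProduct

/-- The submonoid `ℝ≥0` of the additive group `ℝ` (written multiplicatively). -/
def nonnegReals : Submonoid (Multiplicative ℝ) where
  carrier := {t | 0 ≤ t.toAdd}
  one_mem' := le_refl (0 : ℝ)
  mul_mem' := fun {a b} (ha : 0 ≤ a.toAdd) (hb : 0 ≤ b.toAdd) => add_nonneg ha hb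

/-- The topological monoid `*_I ℝ≥0`, a submonoid of the free topological product `*_I ℝ`
endowed with the relative topology. -/
abbrev FreePowerNonneg (I : Type*) : Type _ :=
  FreeTopProd.freeSubmonoid fun _ : I => nonnegReals

section Semigroups

variable (M : Type*) [Monoid M] [TopologicalSpace M]
  (H : Type*) [NormedAddCommGroup H] [InnerProductSpace ℂ H]

/-- An SOT-continuous contractive semigroup over the topological monoid `M` on `H`: a map
`T : M → B(H)` with `T 1 = 1` and `T (x * y) = T x ∘ T y`, with contractions as values, and such
that `x ↦ T x ξ` is norm continuous for every `ξ`. -/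
structure ContractiveSemigroup where
  toHom : M →* (H →L[ℂ] H)
  norm_le_one : ∀ x, ‖toHom x‖ ≤ 1
  sot_continuous : ∀ ξ : H, Continuous fun x => toHom x ξ

namespace ContractiveSemigroup

variable {M H}

/-- The matrix coefficient `x ↦ ⟪η, T x ξ⟫`, as an element of the space of functions `M → ℂ`
with the topology of uniform convergence on compact sets. -/
noncomputable def coeff (T : ContractiveSemigroup M H) (p : H × H) :
    UniformOnFun M ℂ {K : Set M | IsCompact K} :=
  UniformOnFun.ofFun _ fun x => inner ℂ p.2 (T.toHom x p.1)

/-- The topology of uniform weak convergence on compact subsets of `M`: the coarsest topology for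
which, for all `ξ` and `η`, the coefficient map `T ↦ (x ↦ ⟪η, T x ξ⟫)` is continuous into the
functions with uniform convergence on compact sets. -/
noncomputable instance kWOT : TopologicalSpace (ContractiveSemigroup M H) :=
  TopologicalSpace.induced coeff inferInstance

/-- The convergence condition that determines the topology. -/
theorem tendsto_kWOT_iff {A : Type*} {l : Filter A} {F : A → ContractiveSemigroup M H}
    {T : ContractiveSemigroup M H} :
    Filter.Tendsto F l (𝓝 T) ↔ ∀ K : Set M, IsCompact K → ∀ ξ η : H, ∀ ε > (0 : ℝ),
      ∀ᶠ a in l, ∀ x ∈ K, ‖(inner ℂ η (((F a).toHom x - T.toHom x) ξ) : ℂ)‖ < ε := by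
  rw [nhds_induced, Filter.tendsto_comap_iff, tendsto_pi_nhds]
  simp only [UniformOnFun.tendsto_iff_tendstoUniformlyOn, Metric.tendstoUniformlyOn_iff]
  have key : ∀ (a : A) (x : M) (ξ η : H),
      dist (inner ℂ η (T.toHom x ξ) : ℂ) (inner ℂ η ((F a).toHom x ξ)) =
        ‖(inner ℂ η (((F a).toHom x - T.toHom x) ξ) : ℂ)‖ := by
    intro a x ξ η
    rw [dist_comm, dist_eq_norm, sub_apply, inner_sub_right]
  constructor
  · intro h K hK ξ η ε hε
    filter_upwards [h (ξ, η) K hK ε hε] with a ha x hx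
    rw [← key]
    exact ha x hx
  · intro h p K hK ε hε
    filter_upwards [h K hK p.1 p.2 ε hε] with a ha x hx
    have := ha x hx
    rw [← key] at this
    exact this

variable (M H) in
/-- The set of unitary semigroups inside the space of SOT-continuous contractive semigroups. -/
def unitarySemigroups [CompleteSpace H] : Set (ContractiveSemigroup M H) :=
  {T | ∀ x, T.toHom x ∈ unitary (H →L[ℂ] H)}

end ContractiveSemigroup

end Semigroups

/-! Density comes from dilating all the one-parameter semigroups of `T` at once. For each index, the
kernel ⟪T(s-t)ξ, T(t-s)η⟫, with T = 1 at negative times, is positive definite (`norm_proj_sq_le`)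
and yields a strongly continuous unitary group on a space K_i containing H. The K_i are glued along
H into one Hilbert space, where each group acts by the identity off its own K_i. Unitaries form a
topological group in the strong topology, so the universal property of the free topological product
gives a single representation Θ. Induction over words shows that Θ compresses to `T` on H
(`exists_dilation`).

As H is separable and infinite-dimensional, its inclusion into the dilation space is a strong limit
of unitaries W_n. The unitary semigroups W_n⁻¹ Θ W_n then have matrix coefficients converging
uniformly to those of `T`.

For the Gδ part, a contraction is unitary iff neither it nor its adjoint decreases norms. The norm
is weakly lower semicontinuous, so testing on a dense sequence with tolerances 1/(n+1) gives
countably many open conditions. Only the unit time of each index has to be tested, because T(t) is a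
factor of a power of T(1); since the index set is countable, the intersection stays Gδ. -/

/-! ### Strong continuity for families of isometries -/

/-- The set of vectors with continuous orbit under a family of isometries is closed. -/
theorem isClosed_setOf_continuous_apply {X E : Type*} [TopologicalSpace X]
    [SeminormedAddCommGroup E] [NormedSpace ℂ E] (U : X → E ≃ₗᵢ[ℂ] E) :
    IsClosed {v | Continuous fun x => U x v} := by
  rw [← isSeqClosed_iff_isClosed]
  intro v w hv hvw
  -- Isometries do not enlarge the error, so the orbits of `v n` converge uniformly in `x`.
  refine TendstoUniformly.continuous (F := fun n x => U x (v n)) (p := Filter.atTop) ?_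
    (Filter.Frequently.of_forall hv)
  rw [Metric.tendstoUniformly_iff]
  intro ε hε
  filter_upwards [Metric.tendsto_nhds.1 hvw ε hε] with n hn x
  rwa [(U x).dist_map, dist_comm]

/-- Isometries converging at the limit of a family of vectors converge along that family. -/
theorem tendsto_isometry_apply {X E : Type*} [SeminormedAddCommGroup E] [NormedSpace ℂ E]
    {l : Filter X} {U : X → E ≃ₗᵢ[ℂ] E} {f : X → E} {v w : E}
    (hU : Filter.Tendsto (fun x => U x v) l (𝓝 w)) (hf : Filter.Tendsto f l (𝓝 v)) :
    Filter.Tendsto (fun x => U x (f x)) l (𝓝 w) := by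
  have h : Filter.Tendsto (fun x => U x (f x - v)) l (𝓝 0) := by
    rw [tendsto_zero_iff_norm_tendsto_zero]
    simpa only [LinearIsometryEquiv.norm_map] using tendsto_iff_norm_sub_tendsto_zero.1 hf
  simpa using h.add hU

/-! ### Unitary dilation of a one-parameter contraction semigroup -/

/-- A strongly continuous semigroup of contractions on `H`, extended to all of `ℝ` by the identity
on the negative half-line. -/
structure ContractionFlow (H : Type*) [NormedAddCommGroup H] [InnerProductSpace ℂ H] where
  toFun : ℝ → H →L[ℂ] H
  eq_one : ∀ t ≤ 0, toFun t = 1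
  apply_add : ∀ s t, 0 ≤ s → 0 ≤ t → toFun (s + t) = toFun s * toFun t
  norm_le_one : ∀ t, ‖toFun t‖ ≤ 1
  continuous_apply : ∀ ξ, Continuous fun t => toFun t ξ

namespace ContractionFlow

variable {H : Type*} [NormedAddCommGroup H] [InnerProductSpace ℂ H] (T : ContractionFlow H)

theorem norm_apply_le (t : ℝ) (ξ : H) : ‖T.toFun t ξ‖ ≤ ‖ξ‖ := by
  simpa using (T.toFun t).le_of_opNorm_le (T.norm_le_one t) ξ

/-- The finitely supported functions `ℝ → H`, carrying the semi-inner product given by the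
positive definite kernel of the flow `T`. -/
def PreDilation (_ : ContractionFlow H) : Type _ := ℝ →₀ H

noncomputable instance : AddCommGroup T.PreDilation := inferInstanceAs (AddCommGroup (ℝ →₀ H))

noncomputable instance : Module ℂ T.PreDilation := inferInstanceAs (Module ℂ (ℝ →₀ H))

/-- The sesquilinear form of the positive definite kernel of the flow `T`. -/
noncomputable def form (f g : ℝ →₀ H) : ℂ :=
  f.sum fun s ξ => g.sum fun t η => inner ℂ (T.toFun (s - t) ξ) (T.toFun (t - s) η)

theorem form_add_left (f g h : ℝ →₀ H) : T.form (f + g) h = T.form f h + T.form g h := by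
  refine Finsupp.sum_add_index' (fun s => ?_) fun s ξ η => ?_
  · simp
  · simp [Finsupp.sum_add]

theorem form_smul_left (f g : ℝ →₀ H) (c : ℂ) :
    T.form (c • f) g = starRingEnd ℂ c * T.form f g := by
  unfold form
  rw [Finsupp.sum_smul_index' (by simp)]
  simp [Finsupp.sum, Finset.mul_sum, mul_comm]

theorem form_conj_symm (f g : ℝ →₀ H) : starRingEnd ℂ (T.form g f) = T.form f g := by
  unfold form
  rw [Finsupp.sum_comm]
  simp [Finsupp.sum, map_sum]

theorem form_single_single (s t : ℝ) (ξ η : H) :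
    T.form (Finsupp.single s ξ) (Finsupp.single t η) =
      inner ℂ (T.toFun (s - t) ξ) (T.toFun (t - s) η) := by
  simp [form]

theorem form_add_right (f g h : ℝ →₀ H) : T.form f (g + h) = T.form f g + T.form f h := by
  rw [← T.form_conj_symm, form_add_left, map_add, T.form_conj_symm, T.form_conj_symm]

/-- The value at time `a` of the projection onto `H` of a vector supported on `[a, ∞)`. -/
noncomputable def proj (a : ℝ) (f : ℝ →₀ H) : H := f.sum fun t ξ => T.toFun (t - a) ξ

theorem proj_add (a : ℝ) (f g : ℝ →₀ H) : T.proj a (f + g) = T.proj a f + T.proj a g :=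
  Finsupp.sum_add_index' (by simp) (by simp)

theorem proj_single (a t : ℝ) (ξ : H) : T.proj a (Finsupp.single t ξ) = T.toFun (t - a) ξ := by
  simp [proj]

theorem proj_eq {a b : ℝ} (hab : a ≤ b) {f : ℝ →₀ H} (hf : ∀ t ∈ f.support, b ≤ t) :
    T.proj a f = T.toFun (b - a) (T.proj b f) := by
  simp only [proj, Finsupp.sum, map_sum]
  refine Finset.sum_congr rfl fun t ht => ?_
  rw [show t - a = (b - a) + (t - b) by ring,
    T.apply_add _ _ (sub_nonneg.2 hab) (sub_nonneg.2 (hf t ht))]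
  rfl

theorem form_single_left (a : ℝ) (ξ : H) {f : ℝ →₀ H} (hf : ∀ t ∈ f.support, a ≤ t) :
    T.form (Finsupp.single a ξ) f = inner ℂ ξ (T.proj a f) := by
  unfold form proj
  rw [Finsupp.sum_single_index (by simp)]
  simp only [Finsupp.sum, inner_sum]
  refine Finset.sum_congr rfl fun t ht => ?_
  rw [T.eq_one (a - t) (sub_nonpos.2 (hf t ht))]
  rfl

/-- Positivity of the kernel, strengthened so that induction works: peeling off the earliest time
`t` adds ‖ξ‖² + 2 Re⟪ξ, proj t f⟫ to the form, and the inductive bound on `proj t f` completes the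
square. Passing from `t` back to `a` applies a contraction. -/
theorem norm_proj_sq_le (f : ℝ →₀ H) :
    ∀ a, (∀ t ∈ f.support, a ≤ t) → ‖T.proj a f‖ ^ 2 ≤ (T.form f f).re := by
  induction f using Finsupp.induction_on_min with
  | zero => simp [proj, form]
  | single_add t ξ f hf hξ ih =>
    intro a ha
    have hle : ∀ s ∈ (Finsupp.single t ξ + f).support, t ≤ s := by
      intro s hs
      rcases Finset.mem_union.1 (Finsupp.support_add hs) with h | h
      · exact (Finset.mem_singleton.1 (Finsupp.support_single_subset h)).ge
      · exact (hf s h).le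
    have hat : a ≤ t := by
      refine ha t ?_
      have : f t = 0 := by
        by_contra h
        exact lt_irrefl t (hf t (Finsupp.mem_support_iff.2 h))
      simpa [this] using hξ
    rw [T.proj_eq hat hle]
    have h1 := T.norm_apply_le (t - a) (T.proj t (Finsupp.single t ξ + f))
    have h2 := ih t fun s hs => (hf s hs).le
    have h3 : T.proj t (Finsupp.single t ξ + f) = ξ + T.proj t f := by
      rw [proj_add, proj_single, sub_self, T.eq_one 0 le_rfl]; rfl
    have h4 : (T.form (Finsupp.single t ξ + f) (Finsupp.single t ξ + f)).re =
        ‖ξ‖ ^ 2 + 2 * (inner ℂ ξ (T.proj t f)).re + (T.form f f).re := by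
      have h5 := T.form_single_left t ξ fun s hs => (hf s hs).le
      have h6 : (T.form f (Finsupp.single t ξ)).re = (inner ℂ ξ (T.proj t f)).re := by
        rw [← T.form_conj_symm, h5, Complex.conj_re]
      have h7 : (inner ℂ ξ ξ : ℂ).re = ‖ξ‖ ^ 2 := (norm_sq_eq_re_inner (𝕜 := ℂ) ξ).symm
      rw [form_add_left, form_add_right, form_add_right, h5, form_single_single, sub_self,
        T.eq_one 0 le_rfl]
      simp only [Complex.add_re, h6, one_apply_eq_self, h7]
      ring
    have h8 : ‖ξ + T.proj t f‖ ^ 2 =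
        ‖ξ‖ ^ 2 + 2 * (inner ℂ ξ (T.proj t f)).re + ‖T.proj t f‖ ^ 2 :=
      norm_add_sq (𝕜 := ℂ) ξ _
    calc _ ≤ ‖T.proj t (Finsupp.single t ξ + f)‖ ^ 2 := by gcongr
      _ ≤ _ := by rw [h3, h4, h8]; linarith

theorem form_self_nonneg (f : ℝ →₀ H) : 0 ≤ (T.form f f).re := by
  obtain ⟨a, ha⟩ := f.support.finite_toSet.bddBelow
  exact (sq_nonneg _).trans (T.norm_proj_sq_le f a fun t ht => ha ht)

/-- The semi-inner product on the space of finitely supported functions. -/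
noncomputable abbrev preDilationCore : PreInnerProductSpace.Core ℂ T.PreDilation where
  inner := T.form
  conj_inner_symm := T.form_conj_symm
  re_inner_nonneg := T.form_self_nonneg
  add_left := T.form_add_left
  smul_left := T.form_smul_left

noncomputable instance : SeminormedAddCommGroup T.PreDilation :=
  InnerProductSpace.Core.toSeminormedAddCommGroup (c := T.preDilationCore)

noncomputable instance : InnerProductSpace ℂ T.PreDilation :=
  InnerProductSpace.ofCore T.preDilationCore

/-- The Hilbert space of the minimal unitary dilation of the flow `T`. -/
abbrev Dilation : Type _ := UniformSpace.Completion T.PreDilation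

/-- The vector `ξ` placed at time `t`. -/
noncomputable def preVec (t : ℝ) : H →ₗ[ℂ] T.PreDilation := Finsupp.lsingle t

theorem inner_preVec (s t : ℝ) (ξ η : H) :
    inner ℂ (T.preVec s ξ) (T.preVec t η) = inner ℂ (T.toFun (s - t) ξ) (T.toFun (t - s) η) :=
  T.form_single_single s t ξ η

theorem span_preVec : Submodule.span ℂ {v | ∃ t ξ, T.preVec t ξ = v} = ⊤ := by
  rw [eq_top_iff]
  rintro f -
  induction f using Finsupp.induction_linear with
  | zero => exact zero_mem _
  | add f g hf hg => exact add_mem hf hg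
  | single t ξ => exact Submodule.subset_span ⟨t, ξ, rfl⟩

/-- Translation by `r` on the space of finitely supported functions. -/
noncomputable def preShift (r : ℝ) : T.PreDilation ≃ₗ[ℂ] T.PreDilation :=
  Finsupp.domLCongr (Equiv.addLeft r)

theorem preShift_preVec (r t : ℝ) (ξ : H) : T.preShift r (T.preVec t ξ) = T.preVec (r + t) ξ :=
  Finsupp.domLCongr_single _ _ _

/-- The kernel depends only on the difference of the two times. -/
theorem inner_preShift (r : ℝ) (f g : T.PreDilation) :
    inner ℂ (T.preShift r f) (T.preShift r g) = inner ℂ f g := by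
  have hf : f ∈ Submodule.span ℂ {v | ∃ t ξ, T.preVec t ξ = v} := T.span_preVec ▸ trivial
  have hg : g ∈ Submodule.span ℂ {v | ∃ t ξ, T.preVec t ξ = v} := T.span_preVec ▸ trivial
  induction hf, hg using Submodule.span_induction₂ with
  | mem_mem f g hf hg =>
    obtain ⟨s, ξ, rfl⟩ := hf
    obtain ⟨t, η, rfl⟩ := hg
    simp [preShift_preVec, inner_preVec]
  | zero_left => simp
  | zero_right => simp
  | add_left _ _ _ _ _ _ h1 h2 => simp [inner_add_left, h1, h2]
  | add_right _ _ _ _ _ _ h1 h2 => simp [inner_add_right, h1, h2]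
  | smul_left _ _ _ _ _ h => simp [inner_smul_left, h]
  | smul_right _ _ _ _ _ h => simp [inner_smul_right, h]

theorem norm_preShift (r : ℝ) (f : T.PreDilation) : ‖T.preShift r f‖ = ‖f‖ := by
  rw [norm_eq_sqrt_re_inner (𝕜 := ℂ), inner_preShift, ← norm_eq_sqrt_re_inner]

/-- The vector `ξ` placed at time `t`, in the dilation space. -/
noncomputable def vec (t : ℝ) (ξ : H) : T.Dilation := ((T.preVec t ξ : T.PreDilation) : T.Dilation)

theorem inner_vec (s t : ℝ) (ξ η : H) :
    inner ℂ (T.vec s ξ) (T.vec t η) = inner ℂ (T.toFun (s - t) ξ) (T.toFun (t - s) η) := by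
  rw [vec, vec, UniformSpace.Completion.inner_coe, inner_preVec]

theorem dense_span_vec :
    (Submodule.span ℂ {v | ∃ t ξ, T.vec t ξ = v}).topologicalClosure = ⊤ := by
  rw [← Submodule.dense_iff_topologicalClosure_eq_top]
  refine UniformSpace.Completion.denseRange_coe.mono ?_
  rintro _ ⟨f, rfl⟩
  have hf : f ∈ Submodule.span ℂ {v | ∃ t ξ, T.preVec t ξ = v} := T.span_preVec ▸ trivial
  induction hf using Submodule.span_induction with
  | mem f hf =>
    obtain ⟨t, ξ, rfl⟩ := hf
    exact Submodule.subset_span ⟨t, ξ, rfl⟩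
  | zero => exact zero_mem _
  | add f g _ _ hf hg =>
    rw [UniformSpace.Completion.coe_add]
    exact add_mem hf hg
  | smul c f _ hf =>
    rw [UniformSpace.Completion.coe_smul]
    exact Submodule.smul_mem _ c hf

/-- A closed linear property of the vectors `T.vec t ξ` holds on the whole dilation space. -/
theorem closed_induction {p : T.Dilation → Prop} (hvec : ∀ t ξ, p (T.vec t ξ)) (hzero : p 0)
    (hadd : ∀ v w, p v → p w → p (v + w)) (hsmul : ∀ (c : ℂ) v, p v → p (c • v))
    (hp : IsClosed {v | p v}) (v : T.Dilation) : p v := by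
  let S : Submodule ℂ T.Dilation :=
    { carrier := {v | p v}
      add_mem' := fun {v w} => hadd v w
      zero_mem' := hzero
      smul_mem' := fun c v => hsmul c v }
  have h : (Submodule.span ℂ {v | ∃ t ξ, T.vec t ξ = v}).topologicalClosure ≤ S :=
    Submodule.topologicalClosure_minimal _ (Submodule.span_le.2 (by
      rintro _ ⟨t, ξ, rfl⟩
      exact hvec t ξ)) hp
  exact h (T.dense_span_vec ▸ trivial)

/-- Translation by `r` on the dilation space. -/
noncomputable def shift (r : ℝ) : T.Dilation ≃ₗᵢ[ℂ] T.Dilation :=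
  (T.preShift r).extendOfIsometry
    (UniformSpace.Completion.toComplL (𝕜 := ℂ) (E := T.PreDilation)).toLinearMap
    (UniformSpace.Completion.toComplL (𝕜 := ℂ) (E := T.PreDilation)).toLinearMap
    UniformSpace.Completion.denseRange_coe UniformSpace.Completion.denseRange_coe
    fun f => by
      simpa [UniformSpace.Completion.norm_coe] using T.norm_preShift r f

theorem shift_vec (r t : ℝ) (ξ : H) : T.shift r (T.vec t ξ) = T.vec (r + t) ξ := by
  rw [vec, vec, ← preShift_preVec]
  exact LinearEquiv.extendOfIsometry_eq _ _ _ _ _ _ (T.preVec t ξ)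

/-- The unitary dilation of the flow `T`, as a one-parameter group. -/
noncomputable def shiftHom : Multiplicative ℝ →* (T.Dilation ≃ₗᵢ[ℂ] T.Dilation) where
  toFun r := T.shift r.toAdd
  map_one' := by
    ext v
    induction v using T.closed_induction with
    | hvec t ξ => simp [shift_vec]
    | hzero => simp
    | hadd v w hv hw => rw [map_add, hv, hw, map_add]
    | hsmul c v hv => rw [map_smul, hv, map_smul]
    | hp => exact isClosed_eq (by fun_prop) (by fun_prop)
  map_mul' r s := by
    ext v
    induction v using T.closed_induction with
    | hvec t ξ => simp [shift_vec, add_assoc]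
    | hzero => simp
    | hadd v w hv hw => rw [map_add, hv, hw, map_add]
    | hsmul c v hv => rw [map_smul, hv, map_smul]
    | hp => exact isClosed_eq (by fun_prop) (by fun_prop)

/-- The embedding of `H` into the dilation space. -/
noncomputable def embed : H →ₗᵢ[ℂ] T.Dilation where
  toLinearMap := (UniformSpace.Completion.toComplL (𝕜 := ℂ) (E := T.PreDilation)).toLinearMap ∘ₗ
    T.preVec 0
  norm_map' ξ := by
    change ‖T.vec 0 ξ‖ = ‖ξ‖
    rw [norm_eq_sqrt_re_inner (𝕜 := ℂ), inner_vec, sub_self, T.eq_one 0 le_rfl,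
      norm_eq_sqrt_re_inner (𝕜 := ℂ)]
    rfl

theorem embed_apply (ξ : H) : T.embed ξ = T.vec 0 ξ := rfl

/-- The dilation property: compressing the unitary group to `H` recovers the semigroup at
nonnegative times. -/
theorem inner_embed_shift_embed {t : ℝ} (ht : 0 ≤ t) (ξ η : H) :
    inner ℂ (T.embed η) (T.shift t (T.embed ξ)) = inner ℂ η (T.toFun t ξ) := by
  rw [embed_apply, embed_apply, shift_vec, inner_vec, T.eq_one _ (by linarith : 0 - (t + 0) ≤ 0)]
  simp

/-- Expanding ‖vec t ξ - vec s ξ‖² by the kernel leaves an expression that is continuous in `t` by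
strong continuity of the flow and vanishes at `t = s`. -/
theorem continuous_vec (ξ : H) : Continuous fun t => T.vec t ξ := by
  have key : ∀ s t, ‖T.vec t ξ - T.vec s ξ‖ ^ 2 = 2 * ‖ξ‖ ^ 2 -
      2 * (inner ℂ (T.toFun (t - s) ξ) (T.toFun (s - t) ξ)).re := by
    intro s t
    have h : ∀ t, ‖T.vec t ξ‖ = ‖ξ‖ := fun t => by
      rw [← T.embed.norm_map, embed_apply, ← (T.shift t).norm_map (T.vec 0 ξ), shift_vec, add_zero]
    rw [norm_sub_sq (𝕜 := ℂ), inner_vec, h, h]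
    simp only [RCLike.re_eq_complex_re]
    ring
  rw [continuous_iff_continuousAt]
  intro s
  rw [ContinuousAt, tendsto_iff_norm_sub_tendsto_zero]
  have h1 : Filter.Tendsto (fun t => √(‖T.vec t ξ - T.vec s ξ‖ ^ 2)) (𝓝 s) (𝓝 (√0)) := by
    refine (Real.continuous_sqrt.tendsto 0).comp ?_
    simp only [key]
    have h2 : Continuous fun t => 2 * ‖ξ‖ ^ 2 -
        2 * (inner ℂ (T.toFun (t - s) ξ) (T.toFun (s - t) ξ)).re := by
      have h3 := (T.continuous_apply ξ).comp
        (continuous_id.sub continuous_const : Continuous fun t => t - s)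
      have h4 := (T.continuous_apply ξ).comp
        (continuous_const.sub continuous_id : Continuous fun t => s - t)
      exact continuous_const.sub (continuous_const.mul (Complex.continuous_re.comp (h3.inner h4)))
    have h5 := h2.tendsto s
    have h6 : (inner ℂ ξ ξ : ℂ).re = ‖ξ‖ ^ 2 := (norm_sq_eq_re_inner (𝕜 := ℂ) ξ).symm
    simpa only [sub_self, T.eq_one 0 le_rfl, one_apply_eq_self, h6] using h5
  simpa [Real.sqrt_sq (norm_nonneg _)] using h1

theorem continuous_shift_apply (v : T.Dilation) : Continuous fun t => T.shift t v := by
  induction v using T.closed_induction with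
  | hvec t ξ =>
    simp only [shift_vec]
    exact (T.continuous_vec ξ).comp (continuous_id.add continuous_const)
  | hzero => simpa using continuous_const
  | hadd v w hv hw =>
    simp only [map_add]
    exact Continuous.add hv hw
  | hsmul c v hv =>
    simp only [map_smul]
    exact Continuous.const_smul hv c
  | hp => exact isClosed_setOf_continuous_apply T.shift

instance [TopologicalSpace.SeparableSpace H] : TopologicalSpace.SeparableSpace T.Dilation := by
  rw [← TopologicalSpace.isSeparable_univ_iff, ← Submodule.top_coe (R := ℂ), ← T.dense_span_vec]
  refine (TopologicalSpace.IsSeparable.span ?_).closure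
  -- The generating vectors are the continuous image of the separable space ℝ × H.
  have hc : Continuous fun p : ℝ × H => T.vec p.1 p.2 := by
    rw [continuous_iff_continuousAt]
    rintro ⟨t, ξ⟩
    have h := tendsto_isometry_apply (l := 𝓝 (t, ξ)) (U := fun p : ℝ × H => T.shift p.1)
      (f := fun p => T.embed p.2) (v := T.embed ξ) (w := T.shift t (T.embed ξ))
      (((T.continuous_shift_apply _).comp continuous_fst).tendsto _)
      ((T.embed.continuous.comp continuous_snd).tendsto _)
    simpa only [embed_apply, shift_vec, add_zero, ContinuousAt] using h
  refine (TopologicalSpace.isSeparable_range hc).mono ?_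
  rintro _ ⟨t, ξ, rfl⟩
  exact ⟨(t, ξ), rfl⟩

end ContractionFlow

/-! ### Extending operators by the identity along an isometric embedding -/

section Amplification

variable {E K : Type*} [NormedAddCommGroup E] [InnerProductSpace ℂ E] [CompleteSpace E]
  [NormedAddCommGroup K] [InnerProductSpace ℂ K] [CompleteSpace K]

theorem LinearIsometry.adjoint_apply_self (V : E →ₗᵢ[ℂ] K) (v : E) :
    ContinuousLinearMap.adjoint V.toContinuousLinearMap (V v) = v := by
  refine ext_inner_left ℂ fun w => ?_
  rw [ContinuousLinearMap.adjoint_inner_right]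
  exact V.inner_map_map w v

/-- Operators on `E` acting on `K` through an isometric embedding `V`, by the identity on the
orthogonal complement of the range of `V`. -/
noncomputable def amplify (V : E →ₗᵢ[ℂ] K) : (E →L[ℂ] E) →⋆* (K →L[ℂ] K) where
  toFun A := V.toContinuousLinearMap ∘L (A - 1) ∘L
    ContinuousLinearMap.adjoint V.toContinuousLinearMap + 1
  map_one' := by simp
  -- Since V*V = 1, this reduces to (A-1)(B-1) + (A-1) + (B-1) = AB - 1.
  map_mul' A B := by
    ext k
    simp [V.adjoint_apply_self]
    abel
  map_star' A := by
    simp only [ContinuousLinearMap.star_eq_adjoint, map_add, ContinuousLinearMap.adjoint_comp,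
      map_sub, ContinuousLinearMap.adjoint_adjoint, ContinuousLinearMap.comp_assoc]
    simp [← ContinuousLinearMap.star_eq_adjoint]

/-- The amplification of unitary operators along an isometric embedding. -/
noncomputable def amplifyIsometryEquiv (V : E →ₗᵢ[ℂ] K) : (E ≃ₗᵢ[ℂ] E) →* (K ≃ₗᵢ[ℂ] K) :=
  (Unitary.linearIsometryEquiv : unitary (K →L[ℂ] K) ≃* (K ≃ₗᵢ[ℂ] K)).toMonoidHom.comp
    ((Unitary.map (amplify V)).toMonoidHom.comp
      (Unitary.linearIsometryEquiv : unitary (E →L[ℂ] E) ≃* (E ≃ₗᵢ[ℂ] E)).symm.toMonoidHom)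

theorem amplifyIsometryEquiv_apply (V : E →ₗᵢ[ℂ] K) (u : E ≃ₗᵢ[ℂ] E) (k : K) :
    amplifyIsometryEquiv V u k =
      V (u (ContinuousLinearMap.adjoint V.toContinuousLinearMap k) -
        ContinuousLinearMap.adjoint V.toContinuousLinearMap k) + k :=
  rfl

theorem adjoint_amplifyIsometryEquiv (V : E →ₗᵢ[ℂ] K) (u : E ≃ₗᵢ[ℂ] E) (k : K) :
    ContinuousLinearMap.adjoint V.toContinuousLinearMap (amplifyIsometryEquiv V u k) =
      u (ContinuousLinearMap.adjoint V.toContinuousLinearMap k) := by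
  rw [amplifyIsometryEquiv_apply, map_add, V.adjoint_apply_self, sub_add_cancel]

end Amplification

/-! ### Gluing Hilbert spaces along a common subspace -/

section Amalgam

variable {I : Type*} (H : Type*) (K : I → Type*) [NormedAddCommGroup H] [InnerProductSpace ℂ H]
  [CompleteSpace H] [∀ i, NormedAddCommGroup (K i)] [∀ i, InnerProductSpace ℂ (K i)]
  [∀ i, CompleteSpace (K i)]

instance lp.separableSpace [Countable I] [∀ i, TopologicalSpace.SeparableSpace (K i)] :
    TopologicalSpace.SeparableSpace (lp K 2) := by
  classical
  rw [← TopologicalSpace.isSeparable_univ_iff]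
  have h : TopologicalSpace.IsSeparable
      (closure (Submodule.span ℂ (⋃ i, Set.range (lp.single (E := K) 2 i)) : Set (lp K 2))) := by
    refine (TopologicalSpace.IsSeparable.span (TopologicalSpace.IsSeparable.iUnion fun i =>
      TopologicalSpace.isSeparable_range ?_)).closure
    exact (lp.isometry_single (E := K) (p := 2) i).continuous
  refine h.mono fun f _ => ?_
  refine mem_closure_of_tendsto (lp.hasSum_single (by simp) f)
    (Filter.Eventually.of_forall fun s => ?_)
  exact Submodule.sum_mem _ fun i _ =>
    Submodule.subset_span (Set.mem_iUnion.2 ⟨i, Set.mem_range_self _⟩)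

/-- A Hilbert space in which all the `K i` embed, with `H` as their common part. -/
abbrev Amalgam : Type _ := WithLp 2 (H × lp K 2)

variable {H K} (j : ∀ i, H →ₗᵢ[ℂ] K i)

/-- The embedding of the common part. -/
noncomputable def Amalgam.base : H →ₗᵢ[ℂ] Amalgam H K where
  toFun ξ := WithLp.toLp 2 (ξ, 0)
  map_add' ξ η := by rw [← WithLp.toLp_add]; simp
  map_smul' c ξ := by rw [RingHom.id_apply, ← WithLp.toLp_smul]; simp
  norm_map' ξ := by
    change ‖WithLp.toLp 2 (ξ, (0 : lp K 2))‖ = ‖ξ‖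
    simp

open Classical in
/-- The embedding of `K i`. -/
noncomputable def Amalgam.incl (i : I) : K i →ₗᵢ[ℂ] Amalgam H K where
  toFun v := WithLp.toLp 2 (ContinuousLinearMap.adjoint (j i).toContinuousLinearMap v,
    lp.single 2 i (v - j i (ContinuousLinearMap.adjoint (j i).toContinuousLinearMap v)))
  map_add' v w := by
    rw [← WithLp.toLp_add, Prod.mk_add_mk, ← lp.single_add, map_add, map_add,
      add_sub_add_comm]
  map_smul' c v := by
    rw [RingHom.id_apply, ← WithLp.toLp_smul, Prod.smul_mk, ← lp.single_smul, map_smul, map_smul,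
      smul_sub]
  norm_map' v := by
    set a := ContinuousLinearMap.adjoint (j i).toContinuousLinearMap v with ha
    change ‖WithLp.toLp 2 (a, lp.single (E := K) 2 i (v - j i a))‖ = ‖v‖
    -- Pythagoras: `j i a` is the orthogonal projection of `v` onto the copy of `H` in `K i`.
    have h1 : inner ℂ v (j i a) = inner ℂ a a := by
      rw [ha, ContinuousLinearMap.adjoint_inner_left]
      rfl
    have h2 : ‖v - j i a‖ ^ 2 = ‖v‖ ^ 2 - ‖a‖ ^ 2 := by
      rw [norm_sub_sq (𝕜 := ℂ), h1, (j i).norm_map, inner_self_eq_norm_sq]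
      ring
    rw [← sq_eq_sq₀ (norm_nonneg _) (norm_nonneg _), WithLp.prod_norm_sq_eq_of_L2]
    change ‖a‖ ^ 2 + ‖lp.single (E := K) 2 i (v - j i a)‖ ^ 2 = _
    rw [lp.norm_single (by simp), h2]
    ring

theorem Amalgam.incl_comp (i : I) (ξ : H) : incl j i (j i ξ) = base ξ := by
  classical
  change WithLp.toLp 2 (_, lp.single 2 i (j i ξ - j i _)) = WithLp.toLp 2 (ξ, 0)
  rw [(j i).adjoint_apply_self, sub_self, lp.single_zero]

/-- Distinct `K i` and `K l` are orthogonal outside the common part, so projecting from one to the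
other passes through `H`. -/
theorem Amalgam.adjoint_incl_incl {i l : I} (hil : i ≠ l) (v : K i) :
    ContinuousLinearMap.adjoint (incl j l).toContinuousLinearMap (incl j i v) =
      j l (ContinuousLinearMap.adjoint (j i).toContinuousLinearMap v) := by
  classical
  refine ext_inner_left ℂ fun w => ?_
  rw [ContinuousLinearMap.adjoint_inner_right, WithLp.prod_inner_apply]
  change inner ℂ (ContinuousLinearMap.adjoint (j l).toContinuousLinearMap w)
    (ContinuousLinearMap.adjoint (j i).toContinuousLinearMap v) +
    inner ℂ (lp.single 2 l _) (lp.single 2 i _) = _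
  rw [lp.inner_single_left, lp.single_apply_ne _ _ _ hil.symm, inner_zero_right, add_zero,
    ContinuousLinearMap.adjoint_inner_left]
  rfl

theorem Amalgam.adjoint_incl_base (i : I) (ξ : H) :
    ContinuousLinearMap.adjoint (incl j i).toContinuousLinearMap (base ξ) = j i ξ := by
  rw [← incl_comp j i, LinearIsometry.adjoint_apply_self]

theorem Amalgam.adjoint_base (i : I) (k : Amalgam H K) :
    ContinuousLinearMap.adjoint (base : H →ₗᵢ[ℂ] Amalgam H K).toContinuousLinearMap k =
      ContinuousLinearMap.adjoint (j i).toContinuousLinearMap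
        (ContinuousLinearMap.adjoint (incl j i).toContinuousLinearMap k) := by
  refine ext_inner_left ℂ fun ξ => ?_
  simp only [ContinuousLinearMap.adjoint_inner_right]
  change inner ℂ (base ξ) k = inner ℂ (incl j i (j i ξ)) k
  rw [incl_comp]

end Amalgam

/-! ### The unitary group in the strong operator topology -/

section StrongTopology

variable (E : Type*) [NormedAddCommGroup E] [NormedSpace ℂ E]

/-- The strong operator topology on the group of surjective linear isometries. -/
abbrev LinearIsometryEquiv.strongTopology : TopologicalSpace (E ≃ₗᵢ[ℂ] E) :=
  TopologicalSpace.induced (fun u v => u v) inferInstance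

variable {E} in
theorem LinearIsometryEquiv.tendsto_strongTopology_iff {X : Type*} {l : Filter X}
    {U : X → E ≃ₗᵢ[ℂ] E} {u : E ≃ₗᵢ[ℂ] E} :
    Filter.Tendsto U l (@nhds _ (strongTopology E) u) ↔
      ∀ v, Filter.Tendsto (fun x => U x v) l (𝓝 (u v)) := by
  rw [@nhds_induced, Filter.tendsto_comap_iff, tendsto_pi_nhds]
  rfl

/-- Isometry provides the uniform bound needed for joint continuity of products, and inversion is
continuous because ‖w⁻¹v - u⁻¹v‖ = ‖v - w u⁻¹v‖. -/
theorem LinearIsometryEquiv.isTopologicalGroup_strongTopology :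
    @IsTopologicalGroup (E ≃ₗᵢ[ℂ] E) (strongTopology E) _ := by
  let := strongTopology E
  have hev : ∀ (u : E ≃ₗᵢ[ℂ] E) v, Filter.Tendsto (fun w : E ≃ₗᵢ[ℂ] E => w v) (𝓝 u) (𝓝 (u v)) :=
    fun u => tendsto_strongTopology_iff.1 Filter.tendsto_id
  refine @IsTopologicalGroup.mk _ _ _ ⟨?_⟩ ⟨?_⟩
  · rw [continuous_iff_continuousAt]
    rintro ⟨u, w⟩
    refine tendsto_strongTopology_iff.2 fun v => ?_
    have h1 : Filter.Tendsto (fun p : (E ≃ₗᵢ[ℂ] E) × (E ≃ₗᵢ[ℂ] E) => p.1 (w v)) (𝓝 (u, w))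
        (𝓝 (u (w v))) := (hev u (w v)).comp (continuous_fst.tendsto (u, w))
    have h2 : Filter.Tendsto (fun p : (E ≃ₗᵢ[ℂ] E) × (E ≃ₗᵢ[ℂ] E) => p.2 v) (𝓝 (u, w))
        (𝓝 (w v)) := (hev w v).comp (continuous_snd.tendsto (u, w))
    exact tendsto_isometry_apply (U := fun p : (E ≃ₗᵢ[ℂ] E) × (E ≃ₗᵢ[ℂ] E) => p.1)
      (f := fun p => p.2 v) h1 h2
  · rw [continuous_iff_continuousAt]
    intro u
    refine tendsto_strongTopology_iff.2 fun v => ?_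
    rw [tendsto_iff_norm_sub_tendsto_zero]
    have h := tendsto_iff_norm_sub_tendsto_zero.1 (hev u (u⁻¹ v))
    refine h.congr fun w => ?_
    rw [← w.norm_map (w⁻¹ v - u⁻¹ v), map_sub, norm_sub_rev]
    congr 1
    change u (u.symm v) - w (u.symm v) = w (w.symm v) - w (u.symm v)
    simp

end StrongTopology

namespace FreeTopProd

/-- Strongly continuous representations by isometries of the factors induce a strongly continuous
representation of the free topological product. -/
theorem exists_strongly_continuous_lift {I : Type*} {G : I → Type*} [∀ i, Group (G i)]
    [∀ i, TopologicalSpace (G i)] {E : Type*} [NormedAddCommGroup E] [NormedSpace ℂ E]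
    (U : ∀ i, G i →* (E ≃ₗᵢ[ℂ] E)) (hU : ∀ i v, Continuous fun g => U i g v) :
    ∃ Θ : FreeTopProd G →* (E ≃ₗᵢ[ℂ] E), (∀ v, Continuous fun x => Θ x v) ∧
      ∀ i g, Θ (ι i g) = U i g := by
  let := LinearIsometryEquiv.strongTopology E
  have := LinearIsometryEquiv.isTopologicalGroup_strongTopology E
  obtain ⟨Θ, hΘ, h⟩ := exists_continuous_lift U fun i =>
    continuous_induced_rng.2 (continuous_pi (hU i))
  exact ⟨Θ, fun v => (continuous_apply v).comp (continuous_induced_dom.comp hΘ),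
    fun i g => DFunLike.congr_fun (h i) g⟩

end FreeTopProd

/-! ### Simultaneous dilation over the free product -/

namespace ContractiveSemigroup

variable {I H : Type*} [NormedAddCommGroup H] [InnerProductSpace ℂ H]

/-- The element `ι i t` of `*_I ℝ≥0` for `t ≥ 0`. -/
def letter (i : I) : nonnegReals →* FreePowerNonneg I where
  toFun t := ⟨FreeTopProd.ι i t.1, [⟨i, t.1⟩], by simp [t.2], by simp⟩
  map_one' := Subtype.ext (map_one _)
  map_mul' s t := Subtype.ext (map_mul _ _ _)

theorem continuous_letter (i : I) : Continuous (letter i) := by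
  refine continuous_induced_rng.2 ?_
  exact (FreeTopProd.continuous_ι (G := fun _ : I => Multiplicative ℝ) i).comp
    continuous_subtype_val

/-- The positive part of a real number, as an element of `ℝ≥0`. -/
def posPart (t : ℝ) : nonnegReals := ⟨Multiplicative.ofAdd (max t 0), le_max_right t 0⟩

theorem continuous_posPart : Continuous posPart :=
  (continuous_ofAdd.comp (continuous_id.max continuous_const)).subtype_mk _

theorem posPart_toAdd (t : nonnegReals) : posPart t.1.toAdd = t :=
  Subtype.ext (congrArg Multiplicative.ofAdd (max_eq_left t.2))

theorem posPart_add {s t : ℝ} (hs : 0 ≤ s) (ht : 0 ≤ t) :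
    posPart (s + t) = posPart s * posPart t := by
  refine Subtype.ext (congrArg Multiplicative.ofAdd ?_)
  rw [max_eq_left (add_nonneg hs ht)]
  change s + t = max s 0 + max t 0
  rw [max_eq_left hs, max_eq_left ht]

/-- The one-parameter semigroup of a contractive semigroup over `*_I ℝ≥0` at the index `i`. -/
def flow (T : ContractiveSemigroup (FreePowerNonneg I) H) (i : I) : ContractionFlow H where
  toFun t := T.toHom (letter i (posPart t))
  eq_one t ht := by
    have : posPart t = 1 := Subtype.ext (congrArg Multiplicative.ofAdd (max_eq_right ht))
    rw [this, map_one, map_one]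
  apply_add s t hs ht := by rw [posPart_add hs ht, map_mul, map_mul]
  norm_le_one t := T.norm_le_one _
  continuous_apply ξ := (T.sot_continuous ξ).comp ((continuous_letter i).comp continuous_posPart)

theorem flow_toAdd (T : ContractiveSemigroup (FreePowerNonneg I) H) (i : I) (t : nonnegReals) :
    (T.flow i).toFun t.1.toAdd = T.toHom (letter i t) := by
  change T.toHom (letter i (posPart t.1.toAdd)) = _
  rw [posPart_toAdd]

/-- Words need not be reduced, so consecutive letters may share an index. -/
theorem _root_.FreePowerNonneg.induction {p : FreePowerNonneg I → Prop} (one : p 1)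
    (mul : ∀ i t x, p x → p (letter i t * x)) (x : FreePowerNonneg I) : p x := by
  obtain ⟨_, l, hl, rfl⟩ := x
  induction l with
  | nil => exact one
  | cons a l ih =>
    have h := mul a.1 ⟨a.2, hl a (by simp)⟩ _ (ih fun q hq => hl q (by simp [hq]))
    refine (congrArg p (Subtype.ext ?_)).mp h
    exact (List.prod_cons ..).symm

/-- Every contractive semigroup over `*_I ℝ≥0` has a strongly continuous unitary dilation. -/
theorem exists_dilation [CompleteSpace H] (T : ContractiveSemigroup (FreePowerNonneg I) H) :
    ∃ Θ : FreeTopProd (fun _ : I => Multiplicative ℝ) →*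
        (Amalgam H (fun i => (T.flow i).Dilation) ≃ₗᵢ[ℂ]
          Amalgam H (fun i => (T.flow i).Dilation)),
      (∀ v, Continuous fun x => Θ x v) ∧
      ∀ (x : FreePowerNonneg I) (ξ η : H),
        inner ℂ (Amalgam.base η) (Θ x.1 (Amalgam.base ξ)) = inner ℂ η (T.toHom x ξ) := by
  let j := fun i => (T.flow i).embed
  let V := fun i => Amalgam.incl j i
  let U := fun i => (amplifyIsometryEquiv (V i)).comp (T.flow i).shiftHom
  obtain ⟨Θ, hΘ, hι⟩ := FreeTopProd.exists_strongly_continuous_lift U (fun i v => by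
    have h := (T.flow i).continuous_shift_apply
      (ContinuousLinearMap.adjoint (V i).toContinuousLinearMap v)
    exact (((V i).continuous.comp ((h.comp continuous_toAdd).sub continuous_const)).add
      continuous_const))
  refine ⟨Θ, hΘ, fun x ξ η => ?_⟩
  let P := ContinuousLinearMap.adjoint
    (Amalgam.base : H →ₗᵢ[ℂ] Amalgam H (fun i => (T.flow i).Dilation)).toContinuousLinearMap
  -- `S i` collects the vectors on which compression to `H` intertwines the forward shifts with the
  -- semigroup. It contains `H` and is invariant under forward shifts.
  let S : ∀ i, Submodule ℂ (T.flow i).Dilation := fun i =>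
    ⨅ s : nonnegReals, LinearMap.eqLocus
      ((ContinuousLinearMap.adjoint (j i).toContinuousLinearMap).toLinearMap ∘ₗ
        ((T.flow i).shift s.1.toAdd).toLinearEquiv.toLinearMap)
      ((T.toHom (letter i s)).toLinearMap ∘ₗ
        (ContinuousLinearMap.adjoint (j i).toContinuousLinearMap).toLinearMap)
  have hS : ∀ i v, v ∈ S i ↔ ∀ s : nonnegReals,
      ContinuousLinearMap.adjoint (j i).toContinuousLinearMap ((T.flow i).shift s.1.toAdd v) =
      T.toHom (letter i s) (ContinuousLinearMap.adjoint (j i).toContinuousLinearMap v) := by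
    intro i v
    simp only [S, Submodule.mem_iInf]
    rfl
  have hjS : ∀ i ξ, j i ξ ∈ S i := by
    refine fun i ξ => (hS i _).2 fun s => ext_inner_left ℂ fun η => ?_
    rw [(j i).adjoint_apply_self, ContinuousLinearMap.adjoint_inner_right, ← flow_toAdd]
    exact (T.flow i).inner_embed_shift_embed s.2 ξ η
  have hshift : ∀ i (t : nonnegReals), ∀ v ∈ S i, (T.flow i).shift t.1.toAdd v ∈ S i := by
    intro i t v hv
    rw [hS] at hv ⊢
    intro s
    have h : (T.flow i).shift s.1.toAdd ((T.flow i).shift t.1.toAdd v) =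
        (T.flow i).shift (s * t).1.toAdd v :=
      (DFunLike.congr_fun ((T.flow i).shiftHom.map_mul s.1 t.1) v).symm
    rw [h, hv, hv, map_mul, map_mul]
    rfl
  -- The compression identity alone does not propagate; the invariant also keeps every component
  -- V_i* Θ(x)ξ in `S i`, ready for any next letter.
  have key : ∀ x : FreePowerNonneg I,
      (∀ i, ContinuousLinearMap.adjoint (V i).toContinuousLinearMap
        (Θ x.1 (Amalgam.base ξ)) ∈ S i) ∧ P (Θ x.1 (Amalgam.base ξ)) = T.toHom x ξ := by
    intro x
    induction x using FreePowerNonneg.induction with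
    | one =>
      have h1 : Θ (1 : FreePowerNonneg I).1 = 1 := map_one Θ
      rw [h1]
      refine ⟨fun i => ?_, ?_⟩
      · change ContinuousLinearMap.adjoint (V i).toContinuousLinearMap (Amalgam.base ξ) ∈ S i
        rw [Amalgam.adjoint_incl_base j]
        exact hjS i ξ
      · rw [map_one]
        exact LinearIsometry.adjoint_apply_self _ ξ
    | mul i t x ih =>
      set k := Θ x.1 (Amalgam.base ξ) with hk
      have h1 : Θ (letter i t * x).1 (Amalgam.base ξ) =
          amplifyIsometryEquiv (V i) ((T.flow i).shift t.1.toAdd) k := by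
        have h2 : Θ (letter i t * x).1 = U i t.1 * Θ x.1 := by
          rw [← hι]
          exact map_mul Θ _ _
        rw [h2]
        rfl
      rw [h1]
      refine ⟨fun l => ?_, ?_⟩
      · by_cases hil : i = l
        · subst hil
          rw [adjoint_amplifyIsometryEquiv]
          exact hshift i t _ (ih.1 i)
        -- A letter of another index changes this component only by a vector of the copy of `H`,
        -- which lies in `S l`.
        · rw [amplifyIsometryEquiv_apply, map_add, Amalgam.adjoint_incl_incl j hil]
          exact add_mem (hjS l _) (ih.1 l)
      · change ContinuousLinearMap.adjoint _ _ = _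
        rw [Amalgam.adjoint_base j i, adjoint_amplifyIsometryEquiv, (hS i _).1 (ih.1 i) t,
          ← Amalgam.adjoint_base j i, map_mul]
        exact congrArg _ ih.2
  rw [← (key x).2, ContinuousLinearMap.adjoint_inner_right]
  rfl

end ContractiveSemigroup

/-! ### Approximating isometric embeddings by unitaries -/

section Approximation

variable {H K : Type*} [NormedAddCommGroup H] [InnerProductSpace ℂ H]
  [NormedAddCommGroup K] [InnerProductSpace ℂ K]

/-- Orthonormal vectors are at distance √2, so balls of radius 1/2 around them are disjoint. -/
theorem Orthonormal.countable_of_separableSpace [TopologicalSpace.SeparableSpace H] {ι : Type*}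
    {v : ι → H} (hv : Orthonormal ℂ v) : Countable ι := by
  have hinj : Function.Injective v := hv.linearIndependent.injective
  have : (Set.univ : Set ι).Countable := by
    refine Set.PairwiseDisjoint.countable_of_isOpen (s := fun i => Metric.ball (v i) (1 / 2)) ?_
      (fun _ _ => Metric.isOpen_ball) (fun i _ => Metric.nonempty_ball.2 (by norm_num))
    intro i _ k _ hik
    refine Metric.ball_disjoint_ball ?_
    have h : ‖v i - v k‖ ^ 2 = 2 := by
      rw [norm_sub_sq (𝕜 := ℂ), hv.1, hv.1, hv.2 hik]
      norm_num
    rw [dist_eq_norm]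
    nlinarith [norm_nonneg (v i - v k)]
  exact Set.countable_univ_iff.1 this

theorem HilbertBasis.infinite_of_not_finiteDimensional {ι : Type*} (b : HilbertBasis ι ℂ H)
    (hH : ¬ FiniteDimensional ℂ H) : Infinite ι := by
  by_contra h
  rw [not_infinite_iff_finite] at h
  have := Fintype.ofFinite ι
  exact hH b.toOrthonormalBasis.toBasis.finiteDimensional_of_finite

variable [CompleteSpace K] [TopologicalSpace.SeparableSpace H]
  [TopologicalSpace.SeparableSpace K]

/-- An isometric embedding between separable Hilbert spaces of infinite dimension agrees with a
unitary operator on any finite part of an orthonormal basis. -/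
theorem LinearIsometry.exists_linearIsometryEquiv_eqOn (hH : ¬ FiniteDimensional ℂ H)
    (J : H →ₗᵢ[ℂ] K) {ι : Type*} (b : HilbertBasis ι ℂ H) (s : Set ι) (hs : s.Finite) :
    ∃ W : H ≃ₗᵢ[ℂ] K, ∀ i ∈ s, W (b i) = J (b i) := by
  have hK : ¬ FiniteDimensional ℂ K := fun h =>
    hH (FiniteDimensional.of_injective J.toLinearMap J.injective)
  have hJb : Orthonormal ℂ (J ∘ b) := b.orthonormal.comp_linearIsometry J
  have ht : Orthonormal ℂ ((↑) : (J ∘ b) '' s → K) := by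
    rw [Set.image_eq_range]
    exact (hJb.comp _ Subtype.val_injective).toSubtypeRange
  obtain ⟨w, c, hw, hc⟩ := ht.exists_hilbertBasis_extension
  have := b.infinite_of_not_finiteDimensional hH
  have := c.infinite_of_not_finiteDimensional hK
  have := b.orthonormal.countable_of_separableSpace
  have := c.orthonormal.countable_of_separableSpace
  obtain ⟨_⟩ := nonempty_denumerable ι
  obtain ⟨_⟩ := nonempty_denumerable w
  let f : s ↪ w := ⟨fun i => ⟨J (b i), hw ⟨i, i.2, rfl⟩⟩, fun i k hik =>
    Subtype.ext (hJb.linearIndependent.injective (congrArg Subtype.val hik))⟩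
  -- Both bases are countably infinite, so an injection from a finite part extends to a bijection.
  obtain ⟨e, he⟩ := Cardinal.extend_function_of_lt f
    (((Cardinal.lt_aleph0_iff_finite).2 hs).trans_le (Cardinal.aleph0_le_mk ι)) ⟨Denumerable.equiv₂ ι w⟩
  let d : HilbertBasis ι ℂ K := HilbertBasis.mk (c.orthonormal.comp e e.injective) (by
    rw [e.surjective.range_comp, c.dense_span])
  refine ⟨b.repr.trans d.repr.symm, fun i hi => ?_⟩
  classical
  rw [LinearIsometryEquiv.trans_apply, b.repr_self, d.repr_symm_single, HilbertBasis.coe_mk,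
    Function.comp_apply, he ⟨i, hi⟩, hc]
  rfl

/-- An isometric embedding between separable Hilbert spaces of infinite dimension is a strong limit
of unitary operators. -/
theorem LinearIsometry.exists_tendsto_linearIsometryEquiv [CompleteSpace H] (hH : ¬ FiniteDimensional ℂ H)
    (J : H →ₗᵢ[ℂ] K) : ∃ W : ℕ → H ≃ₗᵢ[ℂ] K,
      ∀ ξ, Filter.Tendsto (fun n => W n ξ) Filter.atTop (𝓝 (J ξ)) := by
  obtain ⟨w, b, -⟩ := exists_hilbertBasis ℂ H
  have := b.infinite_of_not_finiteDimensional hH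
  have := b.orthonormal.countable_of_separableSpace
  obtain ⟨_⟩ := nonempty_denumerable w
  choose W hW using fun n : ℕ => J.exists_linearIsometryEquiv_eqOn hH b
    (Denumerable.eqv w ⁻¹' Set.Iio n)
    ((Set.finite_Iio n).preimage (Denumerable.eqv w).injective.injOn)
  refine ⟨W, fun ξ => ?_⟩
  have hspan : ∀ v ∈ Submodule.span ℂ (Set.range b),
      Filter.Tendsto (fun n => W n v) Filter.atTop (𝓝 (J v)) := by
    intro v hv
    induction hv using Submodule.span_induction with
    | mem v hv =>
      obtain ⟨i, rfl⟩ := hv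
      refine tendsto_const_nhds.congr' ?_
      filter_upwards [Filter.eventually_gt_atTop (Denumerable.eqv w i)] with n hn
      exact (hW n i hn).symm
    | zero => simp
    | add v w _ _ hv hw => simpa using hv.add hw
    | smul c v _ hv => simpa using hv.const_smul c
  have hd : Dense (Submodule.span ℂ (Set.range b) : Set H) :=
    Submodule.dense_iff_topologicalClosure_eq_top.2 b.dense_span
  rw [Metric.tendsto_atTop']
  intro ε hε
  obtain ⟨v, hv, hvξ⟩ := Metric.dense_iff.1 hd ξ (ε / 3) (by positivity)
  obtain ⟨N, hN⟩ := Metric.tendsto_atTop'.1 (hspan _ hvξ) (ε / 3) (by positivity)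
  refine ⟨N, fun n hn => ?_⟩
  have h1 := hN n hn
  have h2 : dist (W n ξ) (W n v) < ε / 3 := by
    rw [(W n).dist_map, dist_comm]; exact hv
  have h3 : dist (J v) (J ξ) < ε / 3 := by
    rw [J.dist_map]; exact hv
  linarith [dist_triangle4 (W n ξ) (W n v) (J v) (J ξ)]

end Approximation

namespace ContractiveSemigroup

/-! ### Limits of unitary semigroups -/

section Unitary

variable {M H : Type*} [Monoid M] [TopologicalSpace M] [NormedAddCommGroup H]
  [InnerProductSpace ℂ H]

/-- The contractive semigroup of a strongly continuous homomorphism into the unitary group. -/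
noncomputable def ofIsometryEquiv (U : M →* (H ≃ₗᵢ[ℂ] H)) (hU : ∀ ξ, Continuous fun x => U x ξ) :
    ContractiveSemigroup M H where
  toHom :=
    { toFun := fun x => (U x : H →L[ℂ] H)
      map_one' := by ext; simp
      map_mul' := fun x y => by ext; simp }
  norm_le_one x := ContinuousLinearMap.opNorm_le_bound _ zero_le_one fun ξ => by simp
  sot_continuous := hU

theorem ofIsometryEquiv_mem_unitarySemigroups [CompleteSpace H] (U : M →* (H ≃ₗᵢ[ℂ] H))
    (hU : ∀ ξ, Continuous fun x => U x ξ) : ofIsometryEquiv U hU ∈ unitarySemigroups M H :=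
  fun x => (Unitary.linearIsometryEquiv.symm (U x)).2

/-- A semigroup on an infinite-dimensional separable space with a unitary dilation on a separable
space is a limit of unitary semigroups. -/
theorem mem_closure_unitarySemigroups_of_dilation [CompleteSpace H]
    [TopologicalSpace.SeparableSpace H] (hH : ¬ FiniteDimensional ℂ H)
    {K : Type*} [NormedAddCommGroup K] [InnerProductSpace ℂ K] [CompleteSpace K]
    [TopologicalSpace.SeparableSpace K] (T : ContractiveSemigroup M H) (J : H →ₗᵢ[ℂ] K)
    (U : M →* (K ≃ₗᵢ[ℂ] K)) (hU : ∀ v, Continuous fun x => U x v)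
    (hT : ∀ x ξ η, inner ℂ (J η) (U x (J ξ)) = inner ℂ η (T.toHom x ξ)) :
    T ∈ closure (unitarySemigroups M H) := by
  obtain ⟨W, hW⟩ := J.exists_tendsto_linearIsometryEquiv hH
  let V : ℕ → M →* (H ≃ₗᵢ[ℂ] H) := fun n =>
    { toFun := fun x => ((W n).trans (U x)).trans (W n).symm
      map_one' := by ext; simp
      map_mul' := fun x y => by ext; simp }
  have hV : ∀ n ξ, Continuous fun x => V n x ξ := fun n ξ =>
    (W n).symm.continuous.comp (hU (W n ξ))
  refine mem_closure_of_tendsto (f := fun n => ofIsometryEquiv (V n) (hV n)) (b := Filter.atTop)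
    ?_ (Filter.Eventually.of_forall fun n => ofIsometryEquiv_mem_unitarySemigroups _ _)
  rw [tendsto_kWOT_iff]
  intro C _ ξ η ε hε
  -- This bound does not involve `x`, so the coefficients converge uniformly on all of `M`.
  have h : Filter.Tendsto (fun n => ‖W n η - J η‖ * ‖ξ‖ + ‖η‖ * ‖W n ξ - J ξ‖) Filter.atTop
      (𝓝 (0 * ‖ξ‖ + ‖η‖ * 0)) :=
    ((tendsto_iff_norm_sub_tendsto_zero.1 (hW η)).mul_const _).add
      ((tendsto_iff_norm_sub_tendsto_zero.1 (hW ξ)).const_mul _)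
  rw [zero_mul, mul_zero, add_zero] at h
  filter_upwards [h.eventually_lt_const hε] with n hn x _
  refine lt_of_le_of_lt ?_ hn
  have h1 : (inner ℂ η (((ofIsometryEquiv (V n) (hV n)).toHom x - T.toHom x) ξ) : ℂ) =
      inner ℂ (W n η - J η) (U x (W n ξ)) + inner ℂ (J η) (U x (W n ξ - J ξ)) := by
    have h2 : (inner ℂ η ((ofIsometryEquiv (V n) (hV n)).toHom x ξ) : ℂ) =
        inner ℂ (W n η) (U x (W n ξ)) := by
      rw [← (W n).inner_map_map]
      change inner ℂ (W n η) (W n ((W n).symm (U x (W n ξ)))) = _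
      rw [LinearIsometryEquiv.apply_symm_apply]
    rw [sub_apply, inner_sub_right, h2, ← hT, map_sub, inner_sub_left, inner_sub_right]
    ring
  rw [h1]
  refine (norm_add_le _ _).trans (add_le_add ?_ ?_)
  · have := norm_inner_le_norm (𝕜 := ℂ) (W n η - J η) (U x (W n ξ))
    rwa [(U x).norm_map, (W n).norm_map] at this
  · have := norm_inner_le_norm (𝕜 := ℂ) (J η) (U x (W n ξ - J ξ))
    rwa [(U x).norm_map, J.norm_map] at this

theorem continuous_inner_apply (x : M) (ξ η : H) :
    Continuous fun T : ContractiveSemigroup M H => (inner ℂ η (T.toHom x ξ) : ℂ) := by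
  rw [continuous_iff_continuousAt]
  intro T
  rw [ContinuousAt, Metric.tendsto_nhds]
  intro ε hε
  filter_upwards [tendsto_kWOT_iff.1 (Filter.tendsto_id (x := 𝓝 T)) {x} isCompact_singleton ξ η ε
    hε] with S hS
  rw [dist_eq_norm, ← inner_sub_right]
  exact hS x rfl

end Unitary

/-! ### Unitarity as a Gδ condition -/

section Gdelta

variable {H : Type*} [NormedAddCommGroup H] [InnerProductSpace ℂ H]

theorem _root_.lt_norm_iff_exists_inner {c : ℝ} {v : H} :
    c < ‖v‖ ↔ ∃ η : H, ‖η‖ ≤ 1 ∧ c < ‖(inner ℂ η v : ℂ)‖ := by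
  constructor
  · intro h
    by_cases hv : v = 0
    · exact ⟨0, by simp, by simpa [hv] using h⟩
    · refine ⟨(‖v‖⁻¹ : ℂ) • v, ?_, ?_⟩
      · simp [norm_smul, hv]
      · rw [inner_smul_left, norm_mul, inner_self_eq_norm_sq_to_K]
        have : ‖v‖ ≠ 0 := norm_ne_zero_iff.2 hv
        simpa [sq, this] using h
  · rintro ⟨η, h1, h2⟩
    refine h2.trans_le ((norm_inner_le_norm _ _).trans ?_)
    exact mul_le_of_le_one_left (norm_nonneg _) h1

/-- Weak lower semicontinuity: the norm is a supremum of weakly continuous functions. -/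
theorem _root_.isOpen_setOf_lt_norm {X : Type*} [TopologicalSpace X] {f : X → H}
    (hf : ∀ η : H, Continuous fun x => (inner ℂ η (f x) : ℂ)) (c : ℝ) :
    IsOpen {x | c < ‖f x‖} := by
  have h : {x | c < ‖f x‖} = ⋃ η ∈ Metric.closedBall (0 : H) 1,
      {x | c < ‖(inner ℂ η (f x) : ℂ)‖} := by
    ext x
    rw [Set.mem_ofPred_eq, lt_norm_iff_exists_inner]
    simp
  rw [h]
  exact isOpen_biUnion fun η _ => isOpen_lt continuous_const (hf η).norm

variable [CompleteSpace H]

theorem _root_.ContinuousLinearMap.adjoint_comp_self_eq_one_iff {A : H →L[ℂ] H} (hA : ‖A‖ ≤ 1) :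
    star A * A = 1 ↔ ∀ ξ, ‖ξ‖ ≤ ‖A ξ‖ := by
  have h := ContinuousLinearMap.norm_map_iff_adjoint_comp_self A
  rw [ContinuousLinearMap.star_eq_adjoint]
  refine h.symm.trans (forall_congr' fun ξ => ⟨fun h => h.ge, fun h => le_antisymm ?_ h⟩)
  simpa using A.le_of_opNorm_le hA ξ

theorem _root_.ContinuousLinearMap.mem_unitary_iff_norm_le {A : H →L[ℂ] H} (hA : ‖A‖ ≤ 1) :
    A ∈ unitary (H →L[ℂ] H) ↔ ∀ ξ, ‖ξ‖ ≤ ‖A ξ‖ ∧ ‖ξ‖ ≤ ‖star A ξ‖ := by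
  have hA' : ‖star A‖ ≤ 1 := by rwa [norm_star]
  have h := ContinuousLinearMap.adjoint_comp_self_eq_one_iff hA'
  rw [star_star] at h
  rw [Unitary.mem_iff, ContinuousLinearMap.adjoint_comp_self_eq_one_iff hA, h, forall_and]

/-- A contraction that divides a unitary operator by contractions on both sides is unitary. -/
theorem _root_.ContinuousLinearMap.mem_unitary_of_mul_mem {A B : H →L[ℂ] H} (hA : ‖A‖ ≤ 1)
    (hB : ‖B‖ ≤ 1) (hAB : A * B ∈ unitary (H →L[ℂ] H)) (hBA : B * A ∈ unitary (H →L[ℂ] H)) :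
    A ∈ unitary (H →L[ℂ] H) := by
  have hmul : ∀ {C D : H →L[ℂ] H}, ‖C‖ ≤ 1 → ‖D‖ ≤ 1 → ‖C * D‖ ≤ 1 := fun hC hD =>
    (norm_mul_le _ _).trans (mul_le_one₀ hC (norm_nonneg _) hD)
  rw [ContinuousLinearMap.mem_unitary_iff_norm_le (hmul hA hB)] at hAB
  rw [ContinuousLinearMap.mem_unitary_iff_norm_le (hmul hB hA)] at hBA
  refine (ContinuousLinearMap.mem_unitary_iff_norm_le hA).2 fun ξ => ⟨?_, ?_⟩
  · exact (hBA ξ).1.trans (by simpa using B.le_of_opNorm_le hB (A ξ))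
  · have h := (hAB ξ).2
    rw [star_mul] at h
    have hB' : ‖star B‖ ≤ 1 := by rwa [norm_star]
    exact h.trans (by simpa using (star B).le_of_opNorm_le hB' (star A ξ))

/-- Unitarity at a given point is a `Gδ` condition. -/
theorem isGδ_setOf_mem_unitary {M : Type*} [Monoid M] [TopologicalSpace M]
    [TopologicalSpace.SeparableSpace H] (x : M) :
    IsGδ {T : ContractiveSemigroup M H | T.toHom x ∈ unitary (H →L[ℂ] H)} := by
  have hset : {T : ContractiveSemigroup M H | T.toHom x ∈ unitary (H →L[ℂ] H)} =
      -- `k.1` selects a vector of the dense sequence and `k.2` the tolerance; the tolerance turns ≤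
      -- into strict, open inequalities.
      ⋂ k : ℕ × ℕ, {T | ‖TopologicalSpace.denseSeq H k.1‖ - 1 / (k.2 + 1) <
          ‖T.toHom x (TopologicalSpace.denseSeq H k.1)‖} ∩
        {T | ‖TopologicalSpace.denseSeq H k.1‖ - 1 / (k.2 + 1) <
          ‖(star (T.toHom x) : H →L[ℂ] H) (TopologicalSpace.denseSeq H k.1)‖} := by
    ext T
    have hden : ∀ A : H →L[ℂ] H, (∀ k : ℕ × ℕ, ‖TopologicalSpace.denseSeq H k.1‖ - 1 / (k.2 + 1) <
        ‖A (TopologicalSpace.denseSeq H k.1)‖) ↔ ∀ ξ, ‖ξ‖ ≤ ‖A ξ‖ := by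
      intro A
      constructor
      · intro h ξ
        refine (TopologicalSpace.denseRange_denseSeq H).induction_on
          (p := fun ξ => ‖ξ‖ ≤ ‖A ξ‖) ξ (isClosed_le (by fun_prop) (by fun_prop)) fun m => ?_
        refine le_of_forall_pos_lt_add fun ε hε => ?_
        obtain ⟨n, hn⟩ := exists_nat_one_div_lt hε
        linarith [h (m, n)]
      · intro h k
        have : (0 : ℝ) < 1 / (k.2 + 1) := by positivity
        linarith [h (TopologicalSpace.denseSeq H k.1)]
    simp only [Set.mem_ofPred_eq, Set.mem_iInter, Set.mem_inter_iff]
    rw [ContinuousLinearMap.mem_unitary_iff_norm_le (T.norm_le_one x), forall_and, forall_and,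
      hden, hden]
  rw [hset]
  refine IsGδ.iInter_of_isOpen fun k => IsOpen.inter ?_ ?_
  · exact isOpen_setOf_lt_norm (continuous_inner_apply x _) _
  · refine isOpen_setOf_lt_norm (fun η => ?_) _
    simp only [ContinuousLinearMap.star_eq_adjoint, ContinuousLinearMap.adjoint_inner_right]
    -- Coefficients of the adjoint are conjugates of coefficients of `T`, so taking adjoints
    -- preserves weak continuity.
    simp only [← inner_conj_symm _ (TopologicalSpace.denseSeq H k.1)]
    exact Complex.continuous_conj.comp (continuous_inner_apply x η _)

/-- A contractive semigroup over `*_I ℝ≥0` is unitary once its values at the unit times are. -/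
theorem mem_unitarySemigroups_iff {I : Type*} {T : ContractiveSemigroup (FreePowerNonneg I) H} :
    T ∈ unitarySemigroups (FreePowerNonneg I) H ↔
      ∀ i, T.toHom (letter i (posPart 1)) ∈ unitary (H →L[ℂ] H) := by
  refine ⟨fun h i => h _, fun h x => ?_⟩
  induction x using FreePowerNonneg.induction with
  | one =>
    rw [map_one]
    exact one_mem _
  | mul i t x ih =>
    rw [map_mul]
    refine mul_mem ?_ ih
    -- T(t) and T(n-t) commute with product T(1)^n, which is unitary, so T(t) is unitary.
    obtain ⟨n, hn⟩ := exists_nat_ge t.1.toAdd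
    have hs : ∀ n : ℕ, posPart n = posPart 1 ^ n := by
      intro n
      induction n with
      | zero => exact Subtype.ext (congrArg Multiplicative.ofAdd (by simp))
      | succ n ih => rw [Nat.cast_succ, posPart_add n.cast_nonneg zero_le_one, ih, pow_succ]
    have hn' : posPart (n - t.1.toAdd) * t = posPart 1 ^ n := by
      have h := posPart_add (sub_nonneg.2 hn) t.2
      rw [sub_add_cancel, posPart_toAdd, hs] at h
      exact h.symm
    have hu : T.toHom (letter i (posPart 1 ^ n)) ∈ unitary (H →L[ℂ] H) := by
      rw [map_pow, map_pow]
      exact pow_mem (h i) n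
    refine ContinuousLinearMap.mem_unitary_of_mul_mem (T.norm_le_one _)
      (T.norm_le_one (letter i (posPart (n - t.1.toAdd)))) ?_ ?_
    · rw [← map_mul, ← map_mul, mul_comm, hn']
      exact hu
    · rw [← map_mul, ← map_mul, hn']
      exact hu

end Gdelta

end ContractiveSemigroup

/-! ### Density and the Gδ property -/

theorem mainTheorem9 {I : Type*} [Nonempty I] [Countable I]
    {H : Type*} [NormedAddCommGroup H] [InnerProductSpace ℂ H] [CompleteSpace H]
    [TopologicalSpace.SeparableSpace H] (hH : ¬ FiniteDimensional ℂ H) :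
    Dense (ContractiveSemigroup.unitarySemigroups (FreePowerNonneg I) H) ∧
      IsGδ (ContractiveSemigroup.unitarySemigroups (FreePowerNonneg I) H) := by
  constructor
  · intro T
    obtain ⟨Θ, hΘ, hT⟩ := T.exists_dilation
    -- Second countability of both factors makes the amalgam separable, as the approximation by
    -- unitaries requires.
    have : SecondCountableTopology H := UniformSpace.secondCountable_of_separable H
    have : SecondCountableTopology (lp (fun i => (T.flow i).Dilation) 2) :=
      UniformSpace.secondCountable_of_separable _
    exact T.mem_closure_unitarySemigroups_of_dilation hH Amalgam.base (Θ.comp (Submonoid.subtype _))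
      (fun v => (hΘ v).comp continuous_subtype_val) hT
  · have h : ContractiveSemigroup.unitarySemigroups (FreePowerNonneg I) H = ⋂ i, {T |
        T.toHom (ContractiveSemigroup.letter i (ContractiveSemigroup.posPart 1)) ∈
          unitary (H →L[ℂ] H)} := by
      ext T
      rw [ContractiveSemigroup.mem_unitarySemigroups_iff, Set.mem_iInter]
      rfl
    rw [h]
    exact IsGδ.iInter fun i => ContractiveSemigroup.isGδ_setOf_mem_unitary _
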